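/- Let $d \ge 3$, let $\mathcal H$ be a $d$-dimensional complex Hilbert space with a fixed orthonormal basis, and let $\mathcal H_A$ be an arbitrary complex Hilbert space (the ancilla). For a unitary $W$ on a Hilbert space write $\mathcal U_W(X) = W X W^\dagger$, and for a unitary $U$ on $\mathcal H$ let $U^*$ denote the unitary whose matrix in the fixed basis is the entrywise complex conjugate of that of $U$. Then there is no triple $(\epsilon, \mathcal E, \mathcal D)$ consisting of a real number $\epsilon > 0$ and completely positive trace non-increasing linear maps $$\mathcal E : \mathcal B(\mathcal H) \to \mathcal B(\mathcal H \otimes \mathcal H_A), \qquad \mathcal D : \mathcal B(\mathcal H \otimes \mathcal H_A) \to \mathcal B(\mathcal H)$$ such that for every unitary $U$ on $\mathcal H$ and every density operator $\rho$ on $\mathcal H$ $$\operatorname{Tr}\bigl[\mathcal D \circ (\mathcal U_U \otimes \mathrm{id}_{\mathcal H_A}) \circ \mathcal E(\rho)\bigr] \ge \epsilon \qquad\text{and}\qquad \mathcal D \circ (\mathcal U_U \otimes \mathrm{id}_{\mathcal H_A}) \circ \mathcal E(\rho) \propto \mathcal U_{U^*}(\rho) = U^* \rho\, U^{T},$$ where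 the factor of proportionality may depend on $U$ and $\rho$. (If $\mathcal H_A$ is infinite dimensional, complete positivity and the trace condition are required only on trace class operators, so that maps defined only on the trace class are covered as well.) -/

import Mathlib

open scoped TensorProduct ComplexOrder InnerProductSpace

noncomputable section

namespace QuantumOp

variable {K : Type*} [NormedAddCommGroup K] [InnerProductSpace ℂ K]
variable {L : Type*} [NormedAddCommGroup L] [InnerProductSpace ℂ L]

/-- The trace of a positive bounded operator `X`, with values in `[0, ∞]`: the supremum of the sums
`∑ ⟨v, X v⟩` over all finite orthonormal families. -/
def posTrace (X : K →L[ℂ] K) : ENNReal :=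
  ⨆ (s : Finset K) (_ : Orthonormal ℂ (fun v : s => (v : K))),
    ∑ v ∈ s, ENNReal.ofReal (⟪v, X v⟫_ℂ).re

/-- The trace class operators on `K`: linear combinations of positive bounded operators of finite
trace. If `K` is finite dimensional, these are all the operators on `K`. -/
def traceClass (K : Type*) [NormedAddCommGroup K] [InnerProductSpace ℂ K] :
    Submodule ℂ (K →L[ℂ] K) :=
  Submodule.span ℂ {X | X.IsPositive ∧ posTrace X < ⊤}

/-- The operator `∑ i j, |i⟩⟨j| ⊗ X i j` on `ℂⁿ ⊗ K` is positive. -/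
def BlockPositive {n : ℕ} (X : Fin n → Fin n → (K →L[ℂ] K)) : Prop :=
  ∀ v : Fin n → K, 0 ≤ ∑ i, ∑ j, ⟪v i, X i j (v j)⟫_ℂ

/-- Complete positivity, tested on trace class operators: for every `n`, the map `id ⊗ Φ`, where
`id` is the identity map of the operators on `ℂⁿ`, sends positive operators to positive ones. -/
def IsCompletelyPositive (Φ : (K →L[ℂ] K) →ₗ[ℂ] (L →L[ℂ] L)) : Prop :=
  ∀ (n : ℕ) (X : Fin n → Fin n → (K →L[ℂ] K)), (∀ i j, X i j ∈ traceClass K) →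
    BlockPositive X → BlockPositive fun i j => Φ (X i j)

/-- The trace is not increased on positive operators (this is no condition on those of infinite
trace). -/
def IsTraceNonincreasing (Φ : (K →L[ℂ] K) →ₗ[ℂ] (L →L[ℂ] L)) : Prop :=
  ∀ X : K →L[ℂ] K, X.IsPositive → posTrace (Φ X) ≤ posTrace X

/-- `Φ` acts on trace class operators as a completely positive trace non-increasing map. In finite
dimension this is the usual notion. In infinite dimension nothing is required of the values of `Φ`
outside the trace class, so that every completely positive trace non-increasing linear map which is
only defined on the trace class is covered too (extend it linearly in any way). -/
structure IsQuantumOperation (Φ : (K →L[ℂ] K) →ₗ[ℂ] (L →L[ℂ] L)) : Prop where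
  completelyPositive : IsCompletelyPositive Φ
  traceNonincreasing : IsTraceNonincreasing Φ

/-- The unitary channel `X ↦ W X W†` of the unitary `W`. -/
def unitaryChannel (W : K ≃ₗᵢ[ℂ] K) (X : K →L[ℂ] K) : K →L[ℂ] K :=
  (W : K →L[ℂ] K) ∘L X ∘L (W.symm : K →L[ℂ] K)

/-- Density operators on a finite dimensional Hilbert space. -/
structure IsState (ρ : K →L[ℂ] K) : Prop where
  isPositive : ρ.IsPositive
  trace_eq_one : LinearMap.trace ℂ K (ρ : K →ₗ[ℂ] K) = 1

/-- The operator whose matrix in the orthonormal basis `e` is the entrywise complex conjugate of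
the matrix of `X`. -/
def conjOp {d : ℕ} (e : OrthonormalBasis (Fin d) ℂ K) (X : K →ₗ[ℂ] K) : K →ₗ[ℂ] K :=
  Matrix.toLin e.toBasis e.toBasis ((LinearMap.toMatrix e.toBasis e.toBasis X).map star)

theorem conjOp_comp {d : ℕ} (e : OrthonormalBasis (Fin d) ℂ K) (X Y : K →ₗ[ℂ] K) :
    conjOp e X ∘ₗ conjOp e Y = conjOp e (X ∘ₗ Y) := by
  unfold conjOp
  rw [← Matrix.toLin_mul, LinearMap.toMatrix_comp e.toBasis e.toBasis e.toBasis]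
  congr 1
  ext i j
  simp [Matrix.mul_apply]

theorem conjOp_id {d : ℕ} (e : OrthonormalBasis (Fin d) ℂ K) :
    conjOp e (LinearMap.id : K →ₗ[ℂ] K) = LinearMap.id := by
  unfold conjOp
  rw [LinearMap.toMatrix_id, Matrix.map_one star (star_zero _) (star_one _), Matrix.toLin_one]

theorem inner_conjOp {d : ℕ} (e : OrthonormalBasis (Fin d) ℂ K) (X : K →ₗ[ℂ] K) (i j : Fin d) :
    ⟪e i, conjOp e X (e j)⟫_ℂ = star ⟪e i, X (e j)⟫_ℂ := by
  rw [← e.repr_apply_apply, ← e.repr_apply_apply, ← e.coe_toBasis_repr_apply,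
    ← e.coe_toBasis_repr_apply, ← e.coe_toBasis, ← LinearMap.toMatrix_apply,
    ← LinearMap.toMatrix_apply, conjOp, LinearMap.toMatrix_toLin, Matrix.map_apply]

theorem inner_conjOp_comm {d : ℕ} (e : OrthonormalBasis (Fin d) ℂ K) (U : K ≃ₗᵢ[ℂ] K) (x y : K) :
    ⟪conjOp e (U.toLinearEquiv : K →ₗ[ℂ] K) x, y⟫_ℂ =
      ⟪x, conjOp e (U.symm.toLinearEquiv : K →ₗ[ℂ] K) y⟫_ℂ := by
  have key : (innerₛₗ ℂ : K →ₗ⋆[ℂ] K →ₗ[ℂ] ℂ) ∘ₛₗ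
        conjOp e (U.toLinearEquiv : K →ₗ[ℂ] K) =
      ((innerₛₗ ℂ : K →ₗ⋆[ℂ] K →ₗ[ℂ] ℂ).compl₂
        (conjOp e (U.symm.toLinearEquiv : K →ₗ[ℂ] K))) := by
    refine e.toBasis.ext fun i => e.toBasis.ext fun j => ?_
    simp only [LinearMap.comp_apply, LinearMap.compl₂_apply, innerₛₗ_apply_apply, e.coe_toBasis]
    rw [inner_conjOp, ← inner_conj_symm, inner_conjOp]
    have h : ⟪U (e i), e j⟫_ℂ = ⟪e i, U.symm (e j)⟫_ℂ := by
      rw [← U.inner_map_map (e i), U.apply_symm_apply]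
    have h' := congrArg star h
    rw [← inner_conj_symm (U (e i))] at h'
    simpa using h'
  have := congrArg (fun f => f x y) key
  simpa using this

/-- The complex conjugate `U*` of the unitary `U` in the orthonormal basis `e`. -/
def conjUnitary {d : ℕ} (e : OrthonormalBasis (Fin d) ℂ K) (U : K ≃ₗᵢ[ℂ] K) : K ≃ₗᵢ[ℂ] K :=
  LinearEquiv.isometryOfInner
    (LinearEquiv.ofLinearMap (conjOp e (U.toLinearEquiv : K →ₗ[ℂ] K))
      (conjOp e (U.symm.toLinearEquiv : K →ₗ[ℂ] K))
      (by
        rw [conjOp_comp]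
        convert conjOp_id e
        ext x
        simp)
      (by
        rw [conjOp_comp]
        convert conjOp_id e
        ext x
        simp))
    (by
      intro x y
      simp only [LinearEquiv.coe_ofLinearMap]
      rw [inner_conjOp_comm, ← LinearMap.comp_apply, conjOp_comp]
      have : (U.symm.toLinearEquiv : K →ₗ[ℂ] K) ∘ₗ (U.toLinearEquiv : K →ₗ[ℂ] K) =
          LinearMap.id := by
        ext x
        simp
      rw [this, conjOp_id, LinearMap.id_apply])

end QuantumOp

end

/-!
Only the unitaries `U` which are diagonal in the basis `e`, with phases `z` on the diagonal, are
needed. For them `D ∘ (U ⊗ id) ∘ E` is proportional to the channel of `U* = U⁻¹` on every state,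
and by linearity the factor `p z` is the same for all states. Comparing matrix elements of the
images of `|e a⟩⟨e b|` gives
`∑ i k, (z i / z k) ψ i k a b = p z * (z b / z a)`
for coefficients `ψ` which do not depend on `z`. Averaging over phases which are cube roots of
unity, the mean `m` of `p` is both `∑ i, ψ i i a a`, for every `a`, and `ψ b a a b`, for all
`a ≠ b`. Complete positivity gives `0 ≤ ψ i i a a` and, tested on a vector with entries `1` and
`-1`, `2 m ≤ ψ b b a a + ψ a a b b` for `a ≠ b`. Adding the latter inequalities for the three
pairs from three distinct indices yields `6 m ≤ 3 m`. Since `p ≥ 0`, it follows that `p = 0`.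
-/

noncomputable section

namespace QuantumOp

section PosTrace

variable {K : Type*} [NormedAddCommGroup K] [InnerProductSpace ℂ K]

theorem isPositive_iff_forall_inner_nonneg {X : K →L[ℂ] K} :
    X.IsPositive ↔ ∀ v, 0 ≤ ⟪v, X v⟫_ℂ := by
  refine ⟨fun h v => h.inner_nonneg_right v, fun h => ?_⟩
  refine (ContinuousLinearMap.isPositive_iff_complex X).2 fun v => ?_
  have hv : ⟪X v, v⟫_ℂ = ⟪v, X v⟫_ℂ := by
    rw [← inner_conj_symm]
    exact (IsSelfAdjoint.of_nonneg (h v)).star_eq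
  rw [hv]
  exact ⟨Complex.ext rfl (Complex.le_def.1 (h v)).2, (Complex.le_def.1 (h v)).1⟩

theorem posTrace_mono {X Y : K →L[ℂ] K} (h : X ≤ Y) : posTrace X ≤ posTrace Y := by
  refine iSup₂_mono fun s _ => Finset.sum_le_sum fun v _ => ENNReal.ofReal_le_ofReal ?_
  have hv : 0 ≤ ⟪v, Y v - X v⟫_ℂ := (ContinuousLinearMap.le_def X Y).1 h |>.inner_nonneg_right v
  rw [inner_sub_right, sub_nonneg] at hv
  exact (Complex.le_def.1 hv).1

theorem posTrace_add_le (X Y : K →L[ℂ] K) : posTrace (X + Y) ≤ posTrace X + posTrace Y := by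
  refine iSup₂_le fun s hs => ?_
  calc ∑ v ∈ s, ENNReal.ofReal (⟪v, (X + Y) v⟫_ℂ).re
      ≤ ∑ v ∈ s, (ENNReal.ofReal (⟪v, X v⟫_ℂ).re + ENNReal.ofReal (⟪v, Y v⟫_ℂ).re) := by
        refine Finset.sum_le_sum fun v _ => ?_
        rw [add_apply, inner_add_right, Complex.add_re]
        exact ENNReal.ofReal_add_le
    _ ≤ posTrace X + posTrace Y := by
        rw [Finset.sum_add_distrib]
        exact add_le_add (le_iSup₂_of_le s hs le_rfl) (le_iSup₂_of_le s hs le_rfl)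

theorem posTrace_add_lt_top {X Y : K →L[ℂ] K} (hX : posTrace X < ⊤) (hY : posTrace Y < ⊤) :
    posTrace (X + Y) < ⊤ :=
  (posTrace_add_le X Y).trans_lt (ENNReal.add_lt_top.2 ⟨hX, hY⟩)

theorem posTrace_rankOne_self_lt_top (x : K) :
    posTrace (InnerProductSpace.rankOne ℂ x x) < ⊤ := by
  refine (iSup₂_le fun s hs => ?_).trans_lt (ENNReal.ofReal_lt_top (r := ‖x‖ ^ 2))
  have term (v : K) : (⟪v, InnerProductSpace.rankOne ℂ x x v⟫_ℂ).re = ‖⟪v, x⟫_ℂ‖ ^ 2 := by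
    rw [InnerProductSpace.inner_right_rankOne_apply, ← inner_conj_symm x v, Complex.mul_conj,
      Complex.ofReal_re, Complex.normSq_eq_norm_sq]
  simp only [term]
  rw [← ENNReal.ofReal_sum_of_nonneg fun _ _ => sq_nonneg _, ← Finset.sum_coe_sort s]
  exact ENNReal.ofReal_le_ofReal (hs.sum_inner_products_le x (s := Finset.univ))

theorem mem_traceClass_of_isPositive {X : K →L[ℂ] K} (h : X.IsPositive) (ht : posTrace X < ⊤) :
    X ∈ traceClass K :=
  Submodule.subset_span ⟨h, ht⟩

end PosTrace

section UnitaryChannel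

variable {K : Type*} [NormedAddCommGroup K] [InnerProductSpace ℂ K]

theorem inner_unitaryChannel (W : K ≃ₗᵢ[ℂ] K) (X : K →L[ℂ] K) (v w : K) :
    ⟪v, unitaryChannel W X w⟫_ℂ = ⟪W.symm v, X (W.symm w)⟫_ℂ :=
  (W.symm.inner_map_eq_flip v (X (W.symm w))).symm

theorem isPositive_unitaryChannel (W : K ≃ₗᵢ[ℂ] K) {X : K →L[ℂ] K} (h : X.IsPositive) :
    (unitaryChannel W X).IsPositive :=
  isPositive_iff_forall_inner_nonneg.2 fun v => by
    simpa only [inner_unitaryChannel] using h.inner_nonneg_right (W.symm v)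

theorem posTrace_unitaryChannel_le (W : K ≃ₗᵢ[ℂ] K) (X : K →L[ℂ] K) :
    posTrace (unitaryChannel W X) ≤ posTrace X := by
  classical
  refine iSup₂_le fun s hs => ?_
  have orthonormal_image : Orthonormal ℂ (fun v : s.image W.symm => (v : K)) := by
    have := (hs.comp_linearIsometryEquiv W.symm).toSubtypeRange
    have hr : Set.range (⇑W.symm ∘ fun v : s => (v : K)) = (s.image W.symm : Set K) := by
      simp [Set.range_comp]
    rw [hr] at this
    exact this
  refine le_iSup₂_of_le _ orthonormal_image (le_of_eq ?_)
  rw [Finset.sum_image W.symm.injective.injOn]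
  exact Finset.sum_congr rfl fun v _ => by rw [inner_unitaryChannel]

end UnitaryChannel

section Compression

variable {K : Type*} [NormedAddCommGroup K] [InnerProductSpace ℂ K]

/-- With `V` the reflection `2 P - 1`, one has `2 (P X P + (1 - P) X (1 - P)) = X + V X V†`. -/
theorem compression_le_add_unitaryChannel_reflection (U : Submodule ℂ K)
    [U.HasOrthogonalProjection] {X : K →L[ℂ] K} (hX : X.IsPositive) :
    U.starProjection ∘L X ∘L U.starProjection ≤ X + unitaryChannel U.reflection X := by
  rw [ContinuousLinearMap.le_def, isPositive_iff_forall_inner_nonneg]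
  intro v
  set p := U.starProjection v with hp
  have expand : ⟪v, (X + unitaryChannel U.reflection X -
        U.starProjection ∘L X ∘L U.starProjection) v⟫_ℂ =
      ⟪p, X p⟫_ℂ + 2 * ⟪v - p, X (v - p)⟫_ℂ := by
    simp only [sub_apply, add_apply, inner_sub_right, inner_add_right, inner_unitaryChannel,
      Submodule.reflection_symm, Submodule.reflection_apply, ContinuousLinearMap.comp_apply,
      ← U.inner_starProjection_left_eq_right, ← hp, map_sub, inner_sub_left, two_nsmul,
      map_add, inner_add_left]
    ring
  rw [expand]
  exact add_nonneg (hX.inner_nonneg_right p) (mul_nonneg (by simp) (hX.inner_nonneg_right (v - p)))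

theorem posTrace_compression_lt_top {P : K →L[ℂ] K}
    (hP : (P : K →ₗ[ℂ] K).IsSymmetricProjection) {X : K →L[ℂ] K} (hX : X.IsPositive)
    (ht : posTrace X < ⊤) : posTrace (P ∘L X ∘L P) < ⊤ := by
  obtain ⟨_, hP'⟩ := LinearMap.isSymmetricProjection_iff_eq_coe_starProjection_range.1 hP
  rw [ContinuousLinearMap.coe_inj.1 hP']
  exact (posTrace_mono (compression_le_add_unitaryChannel_reflection _ hX)).trans_lt
    (posTrace_add_lt_top ht ((posTrace_unitaryChannel_le _ _).trans_lt ht))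

end Compression

section BlockPositive

variable {K : Type*} [NormedAddCommGroup K] [InnerProductSpace ℂ K]
variable {n : ℕ} {X : Fin n → Fin n → (K →L[ℂ] K)}

theorem blockPositive_rankOne (x : Fin n → K) :
    BlockPositive fun r s => InnerProductSpace.rankOne ℂ (x r) (x s) := by
  intro v
  have factor : ∑ r, ∑ s, ⟪v r, InnerProductSpace.rankOne ℂ (x r) (x s) (v s)⟫_ℂ =
      (∑ r, ⟪v r, x r⟫_ℂ) * star (∑ s, ⟪v s, x s⟫_ℂ) := by
    rw [star_sum, Finset.sum_mul_sum]
    simp only [InnerProductSpace.inner_right_rankOne_apply, Complex.star_def, inner_conj_symm]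
  rw [factor]
  exact mul_star_self_nonneg _

theorem BlockPositive.compress (hX : BlockPositive X) {P : Fin n → (K →L[ℂ] K)}
    (hP : ∀ r, (P r : K →ₗ[ℂ] K).IsSymmetric) : BlockPositive fun r s => P r ∘L X r s ∘L P s := by
  intro v
  have move (r : Fin n) (u w : K) : ⟪u, P r w⟫_ℂ = ⟪P r u, w⟫_ℂ := (hP r u w).symm
  simpa only [ContinuousLinearMap.comp_apply, move] using hX fun r => P r (v r)

theorem BlockPositive.inner_pair_nonneg (hX : BlockPositive X) (r s : Fin n) (u v : K) :
    0 ≤ ⟪u, X r r u⟫_ℂ + ⟪u, X r s v⟫_ℂ + ⟪v, X s r u⟫_ℂ + ⟪v, X s s v⟫_ℂ := by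
  have sum_single (r s : Fin n) (u v : K) :
      ∑ i, ∑ j, ⟪(Pi.single r u : Fin n → K) i, X i j ((Pi.single s v : Fin n → K) j)⟫_ℂ =
        ⟪u, X r s v⟫_ℂ := by
    rw [Fintype.sum_eq_single r fun i hi => by simp [hi],
      Fintype.sum_eq_single s fun j hj => by simp [hj], Pi.single_eq_same, Pi.single_eq_same]
  convert hX (Pi.single r u + Pi.single s v) using 1
  simp only [Pi.add_apply, map_add, inner_add_left, inner_add_right, Finset.sum_add_distrib,
    sum_single]
  ring

theorem BlockPositive.inner_add_inner_le (hX : BlockPositive X) (r s : Fin n) (u v : K) :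
    ⟪u, X r s v⟫_ℂ + ⟪v, X s r u⟫_ℂ ≤ ⟪u, X r r u⟫_ℂ + ⟪v, X s s v⟫_ℂ := by
  rw [← sub_nonneg]
  convert hX.inner_pair_nonneg r s u (-v) using 1
  simp only [map_neg, inner_neg_left, inner_neg_right]
  ring

theorem BlockPositive.isPositive_pair (hX : BlockPositive X) (r s : Fin n) (w : ℂ) :
    (X r r + w • X r s + star w • X s r + (star w * w) • X s s).IsPositive := by
  rw [isPositive_iff_forall_inner_nonneg]
  intro v
  convert hX.inner_pair_nonneg r s v (w • v) using 1
  simp only [inner_add_right, add_apply, smul_apply, map_smul, inner_smul_left, inner_smul_right,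
    starRingEnd_apply]
  ring

theorem BlockPositive.isPositive_diag (hX : BlockPositive X) (r : Fin n) : (X r r).IsPositive := by
  simpa using hX.isPositive_pair r r 0

theorem BlockPositive.mem_traceClass (hX : BlockPositive X) (ht : ∀ r, posTrace (X r r) < ⊤)
    (r s : Fin n) : X r s ∈ traceClass K := by
  let Y (w : ℂ) : K →L[ℂ] K := X r r + w • X r s + star w • X s r + (star w * w) • X s s
  have mem_Y {w : ℂ} (hw : star w * w = 1) : Y w ∈ traceClass K := by
    have le_diag : Y w ≤ (X r r + X s s) + (X r r + X s s) := by
      rw [ContinuousLinearMap.le_def]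
      convert hX.isPositive_pair r s (-w) using 1
      simp only [Y, star_neg, neg_mul_neg, hw]
      module
    have diag_lt_top := posTrace_add_lt_top (ht r) (ht s)
    exact mem_traceClass_of_isPositive (hX.isPositive_pair r s w)
      ((posTrace_mono le_diag).trans_lt (posTrace_add_lt_top diag_lt_top diag_lt_top))
  have polarization : X r s = (4 : ℂ)⁻¹ •
      (Y 1 - Y (-1) - Complex.I • Y Complex.I + Complex.I • Y (-Complex.I)) := by
    simp only [Y, Complex.star_def, map_neg, map_one, Complex.conj_I, smul_add, smul_smul, neg_mul,
      mul_neg, neg_neg, mul_one, Complex.I_mul_I]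
    module
  rw [polarization]
  refine Submodule.smul_mem _ _ (add_mem (sub_mem (sub_mem (mem_Y ?_) (mem_Y ?_))
    (Submodule.smul_mem _ _ (mem_Y ?_))) (Submodule.smul_mem _ _ (mem_Y ?_))) <;> simp

theorem rankOne_mem_traceClass (x y : K) : InnerProductSpace.rankOne ℂ x y ∈ traceClass K :=
  (blockPositive_rankOne ![x, y]).mem_traceClass (fun _ => posTrace_rankOne_self_lt_top _) 0 1

variable {L : Type*} [NormedAddCommGroup L] [InnerProductSpace ℂ L]

theorem IsCompletelyPositive.isPositive {Φ : (K →L[ℂ] K) →ₗ[ℂ] (L →L[ℂ] L)}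
    (hΦ : IsCompletelyPositive Φ) {Y : K →L[ℂ] K} (hY : Y.IsPositive) (ht : posTrace Y < ⊤) :
    (Φ Y).IsPositive :=
  (hΦ 1 (fun _ _ => Y) (fun _ _ => mem_traceClass_of_isPositive hY ht)
    fun v => by simpa using hY.inner_nonneg_right (v 0)).isPositive_diag 0

end BlockPositive

section Proportionality

theorem eq_or_eq_of_smul_add_smul_eq_smul_add {𝕜 M : Type*} [Field 𝕜] [AddCommGroup M]
    [Module 𝕜 M] (τ : M →ₗ[𝕜] 𝕜) {x y : M} (hx : τ x = 1) (hy : τ y = 1) {r s m : 𝕜}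
    (h : r • x + s • y = m • (x + y)) : r = s ∨ x = y := by
  have coeff_add : r + s = m + m := by simpa [hx, hy] using congrArg τ h
  have coeff_smul : (r - m) • (x - y) = 0 := by
    rw [eq_sub_of_add_eq' coeff_add, ← sub_eq_zero] at h
    rw [← h]
    module
  rcases smul_eq_zero.1 coeff_smul with hr | hxy
  · exact Or.inl (by linear_combination 2 * hr - coeff_add)
  · exact Or.inr (sub_eq_zero.1 hxy)

variable {H : Type*} [NormedAddCommGroup H] [InnerProductSpace ℂ H]

theorem IsState.midpoint {ρ σ : H →L[ℂ] H} (hρ : IsState ρ) (hσ : IsState σ) :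
    IsState ((2 : ℂ)⁻¹ • (ρ + σ)) where
  isPositive := (hρ.isPositive.add hσ.isPositive).smul_of_nonneg (by simp)
  trace_eq_one := by
    rw [ContinuousLinearMap.toLinearMap_smul, map_smul, ContinuousLinearMap.toLinearMap_add,
      map_add, hρ.trace_eq_one, hσ.trace_eq_one]
    norm_num

variable [FiniteDimensional ℂ H]

theorem isState_rankOne_self {x : H} (hx : ‖x‖ = 1) :
    IsState (InnerProductSpace.rankOne ℂ x x) where
  isPositive := InnerProductSpace.isPositive_rankOne_self x
  trace_eq_one := by
    rw [InnerProductSpace.trace_rankOne, inner_self_eq_norm_sq_to_K, hx]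
    simp

theorem trace_eq_zero_iff_of_isPositive {X : H →L[ℂ] H} (hX : X.IsPositive) :
    LinearMap.trace ℂ H (X : H →ₗ[ℂ] H) = 0 ↔ X = 0 := by
  let b := stdOrthonormalBasis ℂ H
  have hM := (LinearMap.posSemidef_toMatrix_iff b).2 hX.toLinearMap
  rw [LinearMap.trace_eq_matrix_trace ℂ b.toBasis, hM.trace_eq_zero_iff,
    LinearEquiv.map_eq_zero_iff, ← ContinuousLinearMap.toLinearMap_zero,
    ContinuousLinearMap.coe_inj]

theorem exists_isState_smul_eq_of_isPositive {X : H →L[ℂ] H} (hX : X.IsPositive) (hX0 : X ≠ 0) :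
    ∃ ρ, IsState ρ ∧ LinearMap.trace ℂ H (X : H →ₗ[ℂ] H) • ρ = X := by
  set t := LinearMap.trace ℂ H (X : H →ₗ[ℂ] H) with ht
  have t_ne_zero : t ≠ 0 := (trace_eq_zero_iff_of_isPositive hX).not.2 hX0
  have t_nonneg : 0 ≤ t := hX.toLinearMap.trace_nonneg
  refine ⟨t⁻¹ • X, ⟨hX.smul_of_nonneg (inv_nonneg.2 t_nonneg), ?_⟩, smul_inv_smul₀ t_ne_zero X⟩
  rw [ContinuousLinearMap.toLinearMap_smul, map_smul, ← ht, smul_eq_mul, inv_mul_cancel₀ t_ne_zero]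

theorem span_isState : Submodule.span ℂ {ρ : H →L[ℂ] H | IsState ρ} = ⊤ := by
  have := FiniteDimensional.complete ℂ H
  have span_isPositive : Submodule.span ℂ {X : H →L[ℂ] H | X.IsPositive} = ⊤ := by
    simpa [ContinuousLinearMap.nonneg_iff_isPositive] using
      CStarAlgebra.span_nonneg (A := H →L[ℂ] H)
  rw [eq_top_iff, ← span_isPositive, Submodule.span_le]
  intro X hX
  by_cases hX0 : X = 0
  · exact hX0 ▸ Submodule.zero_mem _
  · obtain ⟨ρ, hρ, hρX⟩ := exists_isState_smul_eq_of_isPositive hX hX0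
    exact hρX ▸ Submodule.smul_mem _ _ (Submodule.subset_span hρ)

theorem eq_smul_of_forall_isState {M : Type*} [AddCommGroup M] [Module ℂ M]
    {Φ Ψ : (H →L[ℂ] H) →ₗ[ℂ] M} (hΨ : Function.Injective Ψ)
    (h : ∀ ρ, IsState ρ → ∃ c : ℂ, Φ ρ = c • Ψ ρ) {σ : H →L[ℂ] H} (hσ : IsState σ) {c : ℂ}
    (hc : Φ σ = c • Ψ σ) : Φ = c • Ψ := by
  refine LinearMap.ext_on span_isState fun ρ hρ => ?_
  obtain ⟨r, hr⟩ := h ρ hρ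
  obtain ⟨m, hm⟩ := h _ (hρ.midpoint hσ)
  have midpoint_eq : r • ρ + c • σ = m • (ρ + σ) := by
    refine hΨ ((smul_right_injective M (inv_ne_zero (two_ne_zero' ℂ))) ?_)
    simpa [hr, hc, smul_comm m] using hm
  rcases eq_or_eq_of_smul_add_smul_eq_smul_add
    (LinearMap.trace ℂ H ∘ₗ ContinuousLinearMap.coeLM ℂ) hρ.trace_eq_one hσ.trace_eq_one
    midpoint_eq with hrc | hρσ
  · rw [hr, hrc, LinearMap.smul_apply]
  · rw [hρσ, hc, LinearMap.smul_apply]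

end Proportionality

section DiagonalUnitary

variable {ι : Type*} [Fintype ι] {H : Type*} [NormedAddCommGroup H] [InnerProductSpace ℂ H]

/-- The orthonormal basis obtained from `e` by multiplying its vectors by the phases `z`. -/
def phaseBasis (e : OrthonormalBasis ι ℂ H) (z : ι → Circle) : OrthonormalBasis ι ℂ H :=
  (e.toBasis.unitsSMul fun i => Circle.toUnits (z i)).toOrthonormalBasis
    ⟨fun i => by simp [Module.Basis.unitsSMul_apply, Units.smul_def, norm_smul,
        Circle.norm_coe],
      fun i j hij => by
        simp [Module.Basis.unitsSMul_apply, Units.smul_def, inner_smul_left, inner_smul_right,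
          e.orthonormal.2 hij]⟩

/-- The unitary which is diagonal in the basis `e`, with the phases `z` on the diagonal. -/
def diagUnitary (e : OrthonormalBasis ι ℂ H) (z : ι → Circle) : H ≃ₗᵢ[ℂ] H :=
  e.equiv (phaseBasis e z) (Equiv.refl ι)

@[simp]
theorem diagUnitary_apply_basis (e : OrthonormalBasis ι ℂ H) (z : ι → Circle) (i : ι) :
    diagUnitary e z (e i) = (z i : ℂ) • e i := by
  simp [diagUnitary, phaseBasis, Module.Basis.unitsSMul_apply, Units.smul_def]

theorem eq_diagUnitary_of_apply_basis {e : OrthonormalBasis ι ℂ H} {z : ι → Circle}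
    {W : H ≃ₗᵢ[ℂ] H} (h : ∀ i, W (e i) = (z i : ℂ) • e i) : W = diagUnitary e z :=
  LinearIsometryEquiv.toLinearEquiv_injective <| e.toBasis.ext' fun i => by simpa using h i

theorem diagUnitary_symm (e : OrthonormalBasis ι ℂ H) (z : ι → Circle) :
    (diagUnitary e z).symm = diagUnitary e z⁻¹ :=
  eq_diagUnitary_of_apply_basis fun i => by
    rw [LinearIsometryEquiv.symm_apply_eq, map_smul, diagUnitary_apply_basis, smul_smul,
      Pi.inv_apply, ← Circle.coe_mul, inv_mul_cancel, Circle.coe_one, one_smul]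

theorem conjUnitary_diagUnitary {d : ℕ} (e : OrthonormalBasis (Fin d) ℂ H) (z : Fin d → Circle) :
    conjUnitary e (diagUnitary e z) = diagUnitary e z⁻¹ :=
  eq_diagUnitary_of_apply_basis fun j => e.toBasis.ext_elem fun i => by
    have entry : ⟪e i, conjUnitary e (diagUnitary e z) (e j)⟫_ℂ =
        star ⟪e i, diagUnitary e z (e j)⟫_ℂ :=
      inner_conjOp e _ i j
    rw [e.coe_toBasis_repr_apply, e.coe_toBasis_repr_apply, e.repr_apply_apply, e.repr_apply_apply,
      entry, diagUnitary_apply_basis, inner_smul_right, inner_smul_right, star_mul', e.inner_eq_ite,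
      Pi.inv_apply, Circle.coe_inv_eq_conj, apply_ite star, star_one, star_zero, starRingEnd_apply]

theorem inner_unitaryChannel_diagUnitary_inv_rankOne (e : OrthonormalBasis ι ℂ H) (z : ι → Circle)
    (a b : ι) :
    ⟪e a, unitaryChannel (diagUnitary e z⁻¹) (InnerProductSpace.rankOne ℂ (e a) (e b)) (e b)⟫_ℂ =
      ((z b / z a : Circle) : ℂ) := by
  rw [inner_unitaryChannel, diagUnitary_symm, inv_inv, diagUnitary_apply_basis,
    diagUnitary_apply_basis, InnerProductSpace.inner_right_rankOne_apply, inner_smul_left,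
    inner_smul_right, e.inner_eq_one, e.inner_eq_one, mul_one, mul_one, div_eq_inv_mul,
    Circle.coe_mul, Circle.coe_inv_eq_conj]

variable {A : Type*} [NormedAddCommGroup A] [InnerProductSpace ℂ A]

theorem isSymmetricProjection_rTensor {P : H →L[ℂ] H}
    (hP : (P : H →ₗ[ℂ] H).IsSymmetricProjection) :
    (P.rTensor A : H ⊗[ℂ] A →ₗ[ℂ] H ⊗[ℂ] A).IsSymmetricProjection where
  isIdempotentElem := by
    rw [ContinuousLinearMap.toLinearMap_rTensor]
    exact (LinearMap.rTensor_mul A _ _).symm.trans (congrArg _ hP.isIdempotentElem)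
  isSymmetric v w := by
    induction v with
    | zero => simp
    | add v v' hv hv' => rw [map_add, inner_add_left, inner_add_left, hv, hv']
    | tmul x a =>
      induction w with
      | zero => simp
      | add w w' hw hw' => rw [map_add, inner_add_right, inner_add_right, hw, hw']
      | tmul y b =>
        simpa using congrArg (· * ⟪a, b⟫_ℂ) (hP.isSymmetric x y)

variable (A) in
/-- The projection `|e i⟩⟨e i| ⊗ 1`. -/
def coordProj (e : OrthonormalBasis ι ℂ H) (i : ι) : (H ⊗[ℂ] A) →L[ℂ] (H ⊗[ℂ] A) :=
  (InnerProductSpace.rankOne ℂ (e i) (e i)).rTensor A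

theorem isSymmetricProjection_coordProj (e : OrthonormalBasis ι ℂ H) (i : ι) :
    (coordProj A e i : H ⊗[ℂ] A →ₗ[ℂ] H ⊗[ℂ] A).IsSymmetricProjection :=
  isSymmetricProjection_rTensor
    (InnerProductSpace.isSymmetricProjection_rankOne_self (e.norm_eq_one i))

theorem rTensor_diagUnitary_eq_sum (e : OrthonormalBasis ι ℂ H) (z : ι → Circle) :
    ((diagUnitary e z).rTensor A : (H ⊗[ℂ] A) →L[ℂ] (H ⊗[ℂ] A)) =
      ∑ i, (z i : ℂ) • coordProj A e i := by
  classical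
  refine ContinuousLinearMap.coe_injective <| TensorProduct.ext <| e.toBasis.ext fun j => ?_
  ext a
  simp [coordProj, e.inner_eq_ite, TensorProduct.smul_tmul', ite_smul, TensorProduct.ite_tmul]

theorem unitaryChannel_rTensor_diagUnitary (e : OrthonormalBasis ι ℂ H) (z : ι → Circle)
    (X : (H ⊗[ℂ] A) →L[ℂ] (H ⊗[ℂ] A)) :
    unitaryChannel ((diagUnitary e z).rTensor A) X =
      ∑ i, ∑ k, ((z i / z k : Circle) : ℂ) • (coordProj A e i ∘L X ∘L coordProj A e k) := by
  rw [unitaryChannel, LinearIsometryEquiv.symm_rTensor, diagUnitary_symm,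
    rTensor_diagUnitary_eq_sum, rTensor_diagUnitary_eq_sum]
  ext v
  simp only [ContinuousLinearMap.comp_apply, sum_apply, smul_apply, map_sum, map_smul,
    Pi.inv_apply, div_eq_mul_inv, Circle.coe_mul, Finset.smul_sum, smul_smul]
  rw [Finset.sum_comm]
  simp only [mul_comm]

end DiagonalUnitary

section CubicPhases

theorem sum_toCircle_dotProduct {ι : Type*} [Fintype ι] [DecidableEq ι] {N : ℕ} [NeZero N]
    (v : ι → ZMod N) :
    ∑ n : ι → ZMod N, (ZMod.toCircle (n ⬝ᵥ v) : ℂ) =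
      if v = 0 then (Fintype.card (ι → ZMod N) : ℂ) else 0 := by
  let χ : AddChar (ι → ZMod N) ℂ :=
    (ZMod.stdAddChar (N := N)).compAddMonoidHom
      (AddMonoidHom.mk' (· ⬝ᵥ v) fun n m => add_dotProduct n m v)
  have χ_eq_zero_iff : χ = 0 ↔ v = 0 := by
    refine ⟨fun h => funext fun j => ?_, fun h => ?_⟩
    · have hj : ZMod.stdAddChar (v j) = 1 := by
        simpa [χ] using DFunLike.congr_fun h (Pi.single j 1)
      exact ZMod.injective_stdAddChar (hj.trans (AddChar.map_zero_eq_one _).symm)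
    · ext n
      simp [χ, h]
  have sum_χ := AddChar.sum_eq_ite χ
  simp only [χ_eq_zero_iff] at sum_χ
  exact sum_χ

variable {ι : Type*} [DecidableEq ι]

/-- This fails for `ZMod 2`, where `1 + 1 = 0` allows for `i = a` and `k = b`. -/
theorem single_add_single_eq_single_add_single_zmod_three {i k a b : ι} :
    (Pi.single i 1 + Pi.single a 1 : ι → ZMod 3) = Pi.single k 1 + Pi.single b 1 ↔
      (i = k ∧ a = b) ∨ (i = b ∧ a = k) := by
  have two_ne_zero : (1 + 1 : ZMod 3) ≠ 0 := by decide
  rw [Pi.single_add_single_eq_single_add_single one_ne_zero one_ne_zero]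
  simp only [true_and, two_ne_zero, false_and, or_false]

variable [Fintype ι]

/-- The phases `exp (2 π i (n j) / 3)`. Averaging over `n` annihilates every monomial
`(w i / w k) * (w a / w b)` in the phases `w` which is not identically one. -/
def cubicPhase (n : ι → ZMod 3) (j : ι) : Circle := ZMod.toCircle (n j)

theorem sum_cubicPhase_div_mul_div (z : ι → Circle) (i k a b : ι) :
    ∑ n : ι → ZMod 3, (((z i * cubicPhase n i) / (z k * cubicPhase n k) *
        ((z a * cubicPhase n a) / (z b * cubicPhase n b)) : Circle) : ℂ) =
      if (i = k ∧ a = b) ∨ (i = b ∧ a = k) then (Fintype.card (ι → ZMod 3) : ℂ) else 0 := by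
  set v : ι → ZMod 3 := Pi.single i 1 + Pi.single a 1 - (Pi.single k 1 + Pi.single b 1) with hv
  have factor (n : ι → ZMod 3) : (z i * cubicPhase n i) / (z k * cubicPhase n k) *
      ((z a * cubicPhase n a) / (z b * cubicPhase n b)) =
      (z i / z k * (z a / z b)) * ZMod.toCircle (n ⬝ᵥ v) := by
    rw [mul_div_mul_comm, mul_div_mul_comm, mul_mul_mul_comm]
    simp only [hv, dotProduct_sub, dotProduct_add, dotProduct_single_one, AddChar.map_sub_eq_div,
      AddChar.map_add_eq_mul, cubicPhase, div_mul_div_comm]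
  have v_eq_zero_iff : v = 0 ↔ (i = k ∧ a = b) ∨ (i = b ∧ a = k) :=
    sub_eq_zero.trans single_add_single_eq_single_add_single_zmod_three
  simp only [factor, Circle.coe_mul, ← Finset.mul_sum, sum_toCircle_dotProduct, v_eq_zero_iff]
  split_ifs with h
  · rcases h with ⟨rfl, rfl⟩ | ⟨rfl, rfl⟩ <;> simp
  · exact mul_zero _

end CubicPhases

section Coefficients

variable {ι : Type*} [Fintype ι]

theorem nonpos_of_two_mul_le_add_of_sum_eq (hι : 2 < Fintype.card ι) {q : ι → ι → ℝ} {P : ℝ}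
    (hq : ∀ i a, 0 ≤ q i a) (hsum : ∀ a, ∑ i, q i a = P)
    (hpair : ∀ a b, a ≠ b → 2 * P ≤ q b a + q a b) : P ≤ 0 := by
  classical
  obtain ⟨a, b, c, hab, hac, hbc⟩ := Fintype.two_lt_card_iff.1 hι
  have add_le {i k : ι} (hik : i ≠ k) (j : ι) : q i j + q k j ≤ P := by
    rw [← hsum j, ← Finset.sum_pair (f := (q · j)) hik]
    exact Finset.sum_le_univ_sum_of_nonneg fun m => hq m j
  linarith [hpair a b hab, hpair a c hac, hpair b c hbc, add_le hbc a, add_le hac b, add_le hab c]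

variable {ψ : ι → ι → ι → ι → ℂ} {p : (ι → Circle) → ℂ}

theorem sum_mul_cubicPhase_eq [DecidableEq ι]
    (h : ∀ z a b, ∑ i, ∑ k, ((z i / z k : Circle) : ℂ) * ψ i k a b =
      p z * ((z b / z a : Circle) : ℂ)) (z : ι → Circle) (a b : ι) :
    ∑ n : ι → ZMod 3, p (z * cubicPhase n) = ∑ i, ∑ k,
      (if (i = k ∧ a = b) ∨ (i = b ∧ a = k) then (Fintype.card (ι → ZMod 3) : ℂ) else 0) *
        ψ i k a b := by
  have expand (w : ι → Circle) :
      p w = ∑ i, ∑ k, ((w i / w k * (w a / w b) : Circle) : ℂ) * ψ i k a b := by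
    calc p w = p w * ((w b / w a : Circle) : ℂ) * ((w a / w b : Circle) : ℂ) := by
          rw [mul_assoc, ← Circle.coe_mul, div_mul_div_cancel, div_self', Circle.coe_one, mul_one]
      _ = _ := by
          simp only [← h, Finset.sum_mul, Circle.coe_mul, mul_right_comm]
  simp only [expand]
  rw [Finset.sum_comm]
  refine Finset.sum_congr rfl fun i _ => ?_
  rw [Finset.sum_comm]
  refine Finset.sum_congr rfl fun k _ => ?_
  rw [← Finset.sum_mul, ← sum_cubicPhase_div_mul_div z]
  rfl

theorem eq_zero_of_two_lt_card (hι : 2 < Fintype.card ι) (hp : ∀ z, 0 ≤ p z)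
    (h : ∀ z a b, ∑ i, ∑ k, ((z i / z k : Circle) : ℂ) * ψ i k a b =
      p z * ((z b / z a : Circle) : ℂ))
    (hψ : ∀ i a, 0 ≤ ψ i i a a)
    (hpair : ∀ a b, ψ b a a b + ψ a b b a ≤ ψ b b a a + ψ a a b b) (z : ι → Circle) :
    p z = 0 := by
  classical
  set N := Fintype.card (ι → ZMod 3)
  set P := ∑ n : ι → ZMod 3, p (z * cubicPhase n) with hP
  have diag (a : ι) : P = ∑ i, N * ψ i i a a := by
    rw [hP, sum_mul_cubicPhase_eq h z a a]
    have cond (i k : ι) : i = k ∨ (i = a ∧ a = k) ↔ i = k := by grind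
    simp only [and_true, cond, ite_mul, zero_mul, Finset.sum_ite_eq, Finset.mem_univ, if_true, N]
  have off_diag {a b : ι} (hab : a ≠ b) : P = N * ψ b a a b := by
    rw [hP, sum_mul_cubicPhase_eq h z a b]
    simp only [hab, and_false, false_or, ite_and, ite_mul, zero_mul, Finset.sum_ite_irrel,
      Finset.sum_ite_eq, Finset.sum_ite_eq', Finset.sum_const_zero, Finset.mem_univ, if_true, N]
  have P_nonneg : 0 ≤ P := Finset.sum_nonneg fun n _ => hp _
  have P_re_nonpos : P.re ≤ 0 := by
    refine nonpos_of_two_mul_le_add_of_sum_eq hι (q := fun i a => (N * ψ i i a a : ℂ).re)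
      (fun i a => (Complex.le_def.1 (mul_nonneg (Nat.cast_nonneg N) (hψ i a))).1)
      (fun a => by rw [diag a, Complex.re_sum]) fun a b hab => ?_
    have := mul_le_mul_of_nonneg_left (hpair a b) (Nat.cast_nonneg (α := ℂ) N)
    rw [mul_add, mul_add, ← off_diag hab, ← off_diag hab.symm] at this
    simpa [two_mul] using (Complex.le_def.1 this).1
  have P_eq_zero : P = 0 :=
    le_antisymm (Complex.le_def.2 ⟨P_re_nonpos, (Complex.le_def.1 P_nonneg).2.symm⟩) P_nonneg
  have cubicPhase_zero : cubicPhase (0 : ι → ZMod 3) = 1 :=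
    funext fun _ => AddChar.map_zero_eq_one _
  simpa [cubicPhase_zero] using
    (Finset.sum_eq_zero_iff_of_nonneg fun n _ => hp _).1 P_eq_zero 0 (Finset.mem_univ _)

end Coefficients

section Protocol

variable {K : Type*} [NormedAddCommGroup K] [InnerProductSpace ℂ K]

/-- The unitary channel of `W` as a linear map. -/
def unitaryChannelLinear (W : K ≃ₗᵢ[ℂ] K) : (K →L[ℂ] K) →ₗ[ℂ] (K →L[ℂ] K) where
  toFun := unitaryChannel W
  map_add' X Y := by simp only [unitaryChannel, ContinuousLinearMap.add_comp,
    ContinuousLinearMap.comp_add]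
  map_smul' c X := by simp only [unitaryChannel, ContinuousLinearMap.smul_comp,
    ContinuousLinearMap.comp_smul, RingHom.id_apply]

theorem unitaryChannelLinear_injective (W : K ≃ₗᵢ[ℂ] K) :
    Function.Injective (unitaryChannelLinear W) := by
  intro X Y h
  ext v
  have channel_eq : unitaryChannel W X = unitaryChannel W Y := h
  simpa [unitaryChannel] using DFunLike.congr_fun channel_eq (W v)

variable {ι : Type*} [Fintype ι] {H : Type*} [NormedAddCommGroup H] [InnerProductSpace ℂ H]
variable {A : Type*} [NormedAddCommGroup A] [InnerProductSpace ℂ A]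
variable (e : OrthonormalBasis ι ℂ H)
variable {E : (H →L[ℂ] H) →ₗ[ℂ] ((H ⊗[ℂ] A) →L[ℂ] (H ⊗[ℂ] A))}
variable {D : ((H ⊗[ℂ] A) →L[ℂ] (H ⊗[ℂ] A)) →ₗ[ℂ] (H →L[ℂ] H)}

variable (E D) in
/-- The coefficient of `z i / z k` in the matrix element
`⟨e a, (D ∘ (U ⊗ id) ∘ E) (|e a⟩⟨e b|) (e b)⟩` of the protocol with encoder `E` and decoder `D`,
where `U` is the unitary channel of `diagUnitary e z`. -/
def protocolCoeff (i k a b : ι) : ℂ :=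
  ⟪e a, D (coordProj A e i ∘L E (InnerProductSpace.rankOne ℂ (e a) (e b)) ∘L coordProj A e k)
    (e b)⟫_ℂ

variable (E D) in
theorem sum_mul_protocolCoeff (z : ι → Circle) (a b : ι) :
    ∑ i, ∑ k, ((z i / z k : Circle) : ℂ) * protocolCoeff e E D i k a b =
      ⟪e a, D (unitaryChannel ((diagUnitary e z).rTensor A)
        (E (InnerProductSpace.rankOne ℂ (e a) (e b)))) (e b)⟫_ℂ := by
  simp only [unitaryChannel_rTensor_diagUnitary, map_sum, map_smul, sum_apply, smul_apply,
    inner_sum, inner_smul_right, protocolCoeff]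

theorem blockPositive_protocol (hE : IsCompletelyPositive E)
    (hEt : ∀ X, X.IsPositive → posTrace X < ⊤ → posTrace (E X) < ⊤) (hD : IsCompletelyPositive D)
    {n : ℕ} (f g : Fin n → ι) :
    BlockPositive fun r s => D (coordProj A e (f r) ∘L
      E (InnerProductSpace.rankOne ℂ (e (g r)) (e (g s))) ∘L coordProj A e (f s)) := by
  have encoded := hE n _ (fun _ _ => rankOne_mem_traceClass _ _)
    (blockPositive_rankOne fun r => e (g r))
  have compressed := encoded.compress fun r => (isSymmetricProjection_coordProj e (f r)).isSymmetric
  have diag_lt_top (r : Fin n) := posTrace_compression_lt_top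
    (isSymmetricProjection_coordProj e (f r)) (encoded.isPositive_diag r)
    (hEt _ (InnerProductSpace.isPositive_rankOne_self (e (g r)))
      (posTrace_rankOne_self_lt_top (e (g r))))
  exact hD n _ (compressed.mem_traceClass diag_lt_top) compressed

theorem protocolCoeff_nonneg (hE : IsCompletelyPositive E)
    (hEt : ∀ X, X.IsPositive → posTrace X < ⊤ → posTrace (E X) < ⊤) (hD : IsCompletelyPositive D)
    (i a : ι) : 0 ≤ protocolCoeff e E D i i a a :=
  ((blockPositive_protocol e hE hEt hD (fun _ : Fin 1 => i) fun _ => a).isPositive_diag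
    0).inner_nonneg_right (e a)

theorem protocolCoeff_add_le (hE : IsCompletelyPositive E)
    (hEt : ∀ X, X.IsPositive → posTrace X < ⊤ → posTrace (E X) < ⊤) (hD : IsCompletelyPositive D)
    (i k a b : ι) :
    protocolCoeff e E D i k a b + protocolCoeff e E D k i b a ≤
      protocolCoeff e E D i i a a + protocolCoeff e E D k k b b :=
  (blockPositive_protocol e hE hEt hD ![i, k] ![a, b]).inner_add_inner_le 0 1 (e a) (e b)

theorem isPositive_protocol (hE : IsCompletelyPositive E)
    (hEt : ∀ X, X.IsPositive → posTrace X < ⊤ → posTrace (E X) < ⊤) (hD : IsCompletelyPositive D)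
    (W : (H ⊗[ℂ] A) ≃ₗᵢ[ℂ] (H ⊗[ℂ] A)) {X : H →L[ℂ] H} (hX : X.IsPositive)
    (ht : posTrace X < ⊤) : (D (unitaryChannel W (E X))).IsPositive :=
  hD.isPositive (isPositive_unitaryChannel W (hE.isPositive hX ht))
    ((posTrace_unitaryChannel_le W _).trans_lt (hEt X hX ht))

theorem protocolFactor_eq_zero (hι : 2 < Fintype.card ι) (hE : IsCompletelyPositive E)
    (hEt : ∀ X, X.IsPositive → posTrace X < ⊤ → posTrace (E X) < ⊤) (hD : IsCompletelyPositive D)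
    {p : (ι → Circle) → ℂ}
    (h : ∀ z X, D (unitaryChannel ((diagUnitary e z).rTensor A) (E X)) =
      p z • unitaryChannel (diagUnitary e z⁻¹) X) (z : ι → Circle) : p z = 0 := by
  have matrix_element (z : ι → Circle) (a b : ι) :
      ⟪e a, D (unitaryChannel ((diagUnitary e z).rTensor A)
        (E (InnerProductSpace.rankOne ℂ (e a) (e b)))) (e b)⟫_ℂ =
        p z * ((z b / z a : Circle) : ℂ) := by
    rw [h, smul_apply, inner_smul_right, inner_unitaryChannel_diagUnitary_inv_rankOne]
  have p_nonneg (z : ι → Circle) : 0 ≤ p z := by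
    obtain ⟨a⟩ : Nonempty ι := Fintype.card_pos_iff.1 (by lia)
    have := (isPositive_protocol hE hEt hD ((diagUnitary e z).rTensor A)
      (InnerProductSpace.isPositive_rankOne_self (e a))
      (posTrace_rankOne_self_lt_top (e a))).inner_nonneg_right (e a)
    simpa only [matrix_element, div_self', Circle.coe_one, mul_one] using this
  refine eq_zero_of_two_lt_card hι p_nonneg (ψ := protocolCoeff e E D) (fun z a b => ?_)
    (protocolCoeff_nonneg e hE hEt hD) (fun a b => protocolCoeff_add_le e hE hEt hD b a a b) z
  rw [sum_mul_protocolCoeff, matrix_element]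

end Protocol

end QuantumOp

end

theorem mainTheorem3_general {d : ℕ} (hd : 3 ≤ d)
    {H : Type*} [NormedAddCommGroup H] [InnerProductSpace ℂ H]
    (e : OrthonormalBasis (Fin d) ℂ H)
    {A : Type*} [NormedAddCommGroup A] [InnerProductSpace ℂ A]
    {E : (H →L[ℂ] H) →ₗ[ℂ] ((H ⊗[ℂ] A) →L[ℂ] (H ⊗[ℂ] A))}
    {D : ((H ⊗[ℂ] A) →L[ℂ] (H ⊗[ℂ] A)) →ₗ[ℂ] (H →L[ℂ] H)}
    (hE : QuantumOp.IsCompletelyPositive E)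
    (hEt : ∀ X, X.IsPositive → QuantumOp.posTrace X < ⊤ → QuantumOp.posTrace (E X) < ⊤)
    (hD : QuantumOp.IsCompletelyPositive D)
    (h : ∀ (z : Fin d → Circle) (ρ : H →L[ℂ] H), QuantumOp.IsState ρ → ∃ c : ℂ,
      D (QuantumOp.unitaryChannel ((QuantumOp.diagUnitary e z).rTensor A) (E ρ)) =
        c • QuantumOp.unitaryChannel (QuantumOp.conjUnitary e (QuantumOp.diagUnitary e z)) ρ)
    (z : Fin d → Circle) (X : H →L[ℂ] H) :
    D (QuantumOp.unitaryChannel ((QuantumOp.diagUnitary e z).rTensor A) (E X)) = 0 := by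
  have := Module.Finite.of_basis e.toBasis
  have isState := QuantumOp.isState_rankOne_self (e.norm_eq_one ⟨0, by lia⟩)
  simp only [QuantumOp.conjUnitary_diagUnitary] at h
  choose p hp using fun z => h z _ isState
  have proportional (z X) : D (QuantumOp.unitaryChannel ((QuantumOp.diagUnitary e z).rTensor A)
      (E X)) = p z • QuantumOp.unitaryChannel (QuantumOp.diagUnitary e z⁻¹) X :=
    LinearMap.congr_fun (QuantumOp.eq_smul_of_forall_isState
      (Φ := D ∘ₗ QuantumOp.unitaryChannelLinear ((QuantumOp.diagUnitary e z).rTensor A) ∘ₗ E)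
      (QuantumOp.unitaryChannelLinear_injective _) (h z) isState (hp z)) X
  rw [proportional, QuantumOp.protocolFactor_eq_zero e (by simpa only [Fintype.card_fin]) hE hEt hD
    proportional, zero_smul]

theorem mainTheorem3 {d : ℕ} (hd : 3 ≤ d)
    {H : Type*} [NormedAddCommGroup H] [InnerProductSpace ℂ H]
    (e : OrthonormalBasis (Fin d) ℂ H)
    (A : Type*) [NormedAddCommGroup A] [InnerProductSpace ℂ A] [CompleteSpace A] :
    ¬ ∃ (ε : ℝ)
        (E : (H →L[ℂ] H) →ₗ[ℂ] ((H ⊗[ℂ] A) →L[ℂ] (H ⊗[ℂ] A)))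
        (D : ((H ⊗[ℂ] A) →L[ℂ] (H ⊗[ℂ] A)) →ₗ[ℂ] (H →L[ℂ] H)),
      0 < ε ∧ QuantumOp.IsQuantumOperation E ∧ QuantumOp.IsQuantumOperation D ∧
      ∀ (U : H ≃ₗᵢ[ℂ] H) (ρ : H →L[ℂ] H), QuantumOp.IsState ρ →
        ε ≤ (LinearMap.trace ℂ H
          (D (QuantumOp.unitaryChannel (U.rTensor A) (E ρ)) : H →ₗ[ℂ] H)).re ∧
        ∃ c : ℂ, D (QuantumOp.unitaryChannel (U.rTensor A) (E ρ)) =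
          c • QuantumOp.unitaryChannel (QuantumOp.conjUnitary e U) ρ := by
  rintro ⟨ε, E, D, ε_pos, hE, hD, h⟩
  have := Module.Finite.of_basis e.toBasis
  have output_eq_zero := mainTheorem3_general hd e hE.completelyPositive
    (fun X hX ht => (hE.traceNonincreasing X hX).trans_lt ht) hD.completelyPositive
    (fun z ρ hρ => (h (QuantumOp.diagUnitary e z) ρ hρ).2) 1
  have ε_le := (h (QuantumOp.diagUnitary e 1) _
    (QuantumOp.isState_rankOne_self (e.norm_eq_one ⟨0, by lia⟩))).1
  rw [output_eq_zero, ContinuousLinearMap.toLinearMap_zero, map_zero, Complex.zero_re] at ε_le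
  exact ε_pos.not_ge ε_le
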